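/- **Codes.** Let $n\ge 2$, $m\ge 1$, and index the coordinates of $\mathbb F_2^{n^m}$ by $\{0,\dots,n-1\}^m$, so that a vector is a concatenation $(v_0|\cdots|v_{n-1})$ of vectors of length $n^{m-1}$. For $0\le r\le m$ the Berman code $B_n(r,m)\subseteq\mathbb F_2^{n^m}$ is defined by $B_n(m,m)=\{0\}$, $B_n(0,m)=\{c:\sum_i c_i=0\}$ and, for $1\le r\le m-1$, $$B_n(r,m)=\{(v_0|\cdots|v_{n-1}) : v_l\in B_n(r-1,m-1)\ \forall l,\ \textstyle\sum_l v_l\in B_n(r,m-1)\}.$$ The dual Berman code $D_n(r,m)\subseteq\mathbb F_2^{n^m}$ is defined by $D_n(m,m)=\mathbb F_2^{n^m}$, $D_n(0,m)=\{(c,\dots,c)\}$ and, for $1\le r\le m-1$, $$D_n(r,m)=\{(u+u_0|\cdots|u+u_{n-2}|u) : u_l\in D_n(r-1,m-1)\ \forall l,\ u\in D_n(r,m-1)\}.$$ **Star product schemes.** Let $\mathcal C,\mathcal D\subseteq\mathbb F^{N}$ be linear codes over a finite field, $k=\dim\mathcal C$, and let $\mathcal C\star\mathcal D$ be the span of all componentwise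 products $c\star d$ with $c\in\mathcal C$, $d\in\mathcal D$. Let $G$ be a generator matrix of $\mathcal C$. For $M$ files $X_f\in\mathbb F^{b\times k}$, stacked to an $Mb\times k$ matrix $X$, server $i\in\{1,\dots,N\}$ stores the $i$-th column $Y_i$ of $Y=XG$; the storage rate is $R_{st}=k/N$. A star product scheme with storage code $\mathcal C$ and retrieval code $\mathcal D$ consists of integers $b,S\ge 1$, matrices $E^{(d,s)}\in\mathbb F^{Mb\times N}$ for each file index $d$ and each iteration $s=1,\dots,S$, and a reconstruction function. In iteration $s$ the client who wants file $d$ sends to server $i$ the $i$-th column $q_i$ of $R^{(s)}+E^{(d,s)}$ and receives $\langle q_i,Y_i\rangle$, where all rows of all matrices $R^{(s)}$ are independent and uniform on $\mathcal D$. From $d$ and the classes modulo $\mathcal C\star\mathcal D$ (the syndromes) of the $S$ response vectors, the reconstruction function always recovers $X_d$. Its PIR rate is $R_{PIR}=bk/(SN)$. It is a $t$-PIR scheme if for every set $T$ of $t$ servers and every distribution of the demand $d$ (independent of the matrices $R^{(s)}$) the queries sent to $T$ in all iterations have mutual information $0$ with $d$. **Theorem.** Let $n\ge2$ and $m\ge1$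 be integers. For each of the following choices, for every number $M$ of files and every generator matrix of $\mathcal C$, there is a star product $t$-PIR scheme on $n^m$ servers with storage code $\mathcal C$ and retrieval code $\mathcal D$ and with the following parameters ($r_C,r_D\ge 0$ are integers). 1. $\mathcal C=D_n(r_C,m)$, $\mathcal D=D_n(r_D,m)$ with $r_C+r_D<m$: $$R_{st}=\frac{\sum_{i=0}^{r_C}\binom mi(n-1)^i}{n^m},\quad R_{PIR}=\frac{\sum_{i=r_C+r_D+1}^{m}\binom mi(n-1)^i}{n^m},\quad t=2^{r_D+1}-1.$$ 2. $\mathcal C=D_n(r_C,m)$, $\mathcal D=B_n(r_D,m)$ with $r_C\le r_D\le m$: $$R_{st}=\frac{\sum_{i=0}^{r_C}\binom mi(n-1)^i}{n^m},\quad R_{PIR}=\frac{\sum_{i=0}^{r_D-r_C}\binom mi(n-1)^i}{n^m},\quad t=n^{m-r_D}-1.$$ 3. $\mathcal C=B_n(r_C,m)$, $\mathcal D=D_n(r_D,m)$ with $r_D\le r_C<m$: $$R_{st}=\frac{\sum_{i=r_C+1}^{m}\binom mi(n-1)^i}{n^m},\quad R_{PIR}=\frac{\sum_{i=0}^{r_C-r_D}\binom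 mi(n-1)^i}{n^m},\quad t=2^{r_D+1}-1.$$ -/

import Mathlib

open scoped BigOperators

/-! ### Berman and dual Berman codes

The `n ^ m` coordinates are indexed by the `m`-tuples `Fin m → Fin n`.  A vector of length
`n ^ (m + 1)` is the concatenation `(v₀ | ⋯ | vₙ₋₁)` of the blocks `v_l = block v l`. -/

/-- The `l`-th block (of length `n ^ m`) of a vector of length `n ^ (m + 1)`. -/
def block {n m : ℕ} (v : (Fin (m + 1) → Fin n) → ZMod 2) (l : Fin n) :
    (Fin m → Fin n) → ZMod 2 :=
  fun i => v (Fin.cons l i)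

/-- The Berman code with parameters `n, m, r` (meant for `1 ≤ m` and `r ≤ m`): the zero code if
`r = m`, the even-weight code if `r = 0`, and otherwise
`{(v₀ | ⋯ | vₙ₋₁) : v_l ∈ berman n (m - 1) (r - 1), ∑ v_l ∈ berman n (m - 1) r}`. -/
def berman (n : ℕ) : (m r : ℕ) → Submodule (ZMod 2) ((Fin m → Fin n) → ZMod 2)
  | 0, _ => ⊥
  | _ + 1, 0 =>
    { carrier := {c | ∑ i, c i = 0}
      add_mem' := by
        intro a b ha hb
        simp only [Set.mem_ofPred_eq, Pi.add_apply, Finset.sum_add_distrib] at *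
        rw [ha, hb, add_zero]
      zero_mem' := by simp
      smul_mem' := by
        intro c a ha
        simp only [Set.mem_ofPred_eq, Pi.smul_apply, ← Finset.smul_sum] at *
        rw [ha, smul_zero] }
  | m + 1, r + 1 =>
    if m ≤ r then ⊥ else
    { carrier := {v | (∀ l, block v l ∈ berman n m r) ∧ ∑ l, block v l ∈ berman n m (r + 1)}
      add_mem' := by
        rintro a b ⟨ha, ha'⟩ ⟨hb, hb'⟩
        refine ⟨fun l => (berman n m r).add_mem (ha l) (hb l), ?_⟩
        have h := (berman n m (r + 1)).add_mem ha' hb'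
        rw [← Finset.sum_add_distrib] at h
        exact h
      zero_mem' := by
        refine ⟨fun l => (berman n m r).zero_mem, (berman n m (r + 1)).sum_mem fun l _ => ?_⟩
        exact (berman n m (r + 1)).zero_mem
      smul_mem' := by
        rintro c a ⟨ha, ha'⟩
        refine ⟨fun l => (berman n m r).smul_mem c (ha l), ?_⟩
        have h := (berman n m (r + 1)).smul_mem c ha'
        rw [Finset.smul_sum] at h
        exact h }

/-- The dual Berman code with parameters `n, m, r` (meant for `1 ≤ m` and `r ≤ m`): the full space
if `r = m`, the repetition code if `r = 0`, and otherwise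
`{(u + u₀ | ⋯ | u + uₙ₋₂ | u) : u_l ∈ dualBerman n (m - 1) (r - 1), u ∈ dualBerman n (m - 1) r}`
(below, `w l` is `u_l` for `l < n - 1` and `0` for `l = n - 1`). -/
def dualBerman (n : ℕ) : (m r : ℕ) → Submodule (ZMod 2) ((Fin m → Fin n) → ZMod 2)
  | 0, _ => ⊤
  | _ + 1, 0 =>
    { carrier := {v | ∃ c : ZMod 2, v = fun _ => c}
      add_mem' := by
        rintro _ _ ⟨a, rfl⟩ ⟨b, rfl⟩
        exact ⟨a + b, rfl⟩
      zero_mem' := ⟨0, rfl⟩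
      smul_mem' := by
        rintro c _ ⟨a, rfl⟩
        exact ⟨c * a, rfl⟩ }
  | m + 1, r + 1 =>
    if m ≤ r then ⊤ else
    { carrier := {v | ∃ u ∈ dualBerman n m (r + 1), ∃ w : Fin n → (Fin m → Fin n) → ZMod 2,
        (∀ l, w l ∈ dualBerman n m r) ∧ (∀ l : Fin n, (l : ℕ) + 1 = n → w l = 0) ∧
        ∀ l, block v l = u + w l}
      add_mem' := by
        rintro a b ⟨u, hu, w, hw, hw0, h⟩ ⟨u', hu', w', hw', hw0', h'⟩
        refine ⟨u + u', (dualBerman n m (r + 1)).add_mem hu hu', w + w',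
          fun l => (dualBerman n m r).add_mem (hw l) (hw' l), fun l hl => ?_, fun l => ?_⟩
        · simp [hw0 l hl, hw0' l hl]
        · have e : block (a + b) l = block a l + block b l := rfl
          rw [e, h l, h' l, Pi.add_apply]
          abel
      zero_mem' := ⟨0, (dualBerman n m (r + 1)).zero_mem, 0,
        fun _ => (dualBerman n m r).zero_mem, fun _ _ => rfl, fun _ => (add_zero 0).symm⟩
      smul_mem' := by
        rintro c a ⟨u, hu, w, hw, hw0, h⟩
        refine ⟨c • u, (dualBerman n m (r + 1)).smul_mem c hu, c • w,
          fun l => (dualBerman n m r).smul_mem c (hw l), fun l hl => ?_, fun l => ?_⟩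
        · simp [hw0 l hl]
        · have e : block (c • a) l = c • block a l := rfl
          rw [e, h l, Pi.smul_apply, smul_add] }

/-! ### Private information retrieval with storage code `C` and retrieval code `D`

The servers are indexed by a finite type `ι`; codes are subspaces of `ι → F`. -/

/-- The star product of two codes: the span of all componentwise products of codewords. -/
def starProduct {F ι : Type*} [Field F] (C D : Submodule F (ι → F)) : Submodule F (ι → F) :=
  Submodule.span F {x | ∃ c ∈ C, ∃ d ∈ D, x = c * d}

/-- `G` is a generator matrix of the code `C`: its rows form a basis of `C`. -/
def IsGeneratorMatrix {F ι : Type*} [Field F] {k : ℕ} (G : Matrix (Fin k) ι F)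
    (C : Submodule F (ι → F)) : Prop :=
  LinearIndependent F G.row ∧ Submodule.span F (Set.range G.row) = C

/-- The stored matrix `Y = X G`, where `X` is the `M b × k` matrix obtained by stacking the `M`
files `X f`, each a `b × k` matrix.  Server `i` stores the `i`-th column of `Y`. -/
def storedMatrix {F ι : Type*} [Field F] {k b M : ℕ} (G : Matrix (Fin k) ι F)
    (X : Fin M → Matrix (Fin b) (Fin k) F) : Matrix (Fin M × Fin b) ι F :=
  (Matrix.of fun (p : Fin M × Fin b) j => X p.1 p.2 j) * G

/-- The responses in one iteration: server `i` answers the dot product of the `i`-th column of the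
query matrix `Q` with the `i`-th column of the stored matrix `Y`. -/
def response {F ι : Type*} [Field F] {b M : ℕ} (Q Y : Matrix (Fin M × Fin b) ι F) : ι → F :=
  fun i => ∑ p, Q p i * Y p i

/-- A star product PIR scheme for `M` files on the storage system `Y = X G`, with storage code `C`
(generated by `G`) and retrieval code `D`.  In iteration `s` the client who wants file `d` sends
the columns of `Q = R + E d s` to the servers, where the rows of `R` are random codewords of `D`;
it then recovers file `d` from the responses of all `S` iterations. -/
structure StarProductScheme {F ι : Type*} [Field F] {k : ℕ}
    (C D : Submodule F (ι → F)) (G : Matrix (Fin k) ι F) (M : ℕ) where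
  /-- the number of rows of each file -/
  b : ℕ
  /-- the number of iterations -/
  S : ℕ
  b_pos : 0 < b
  S_pos : 0 < S
  /-- the designed part of the query matrices -/
  E : Fin M → Fin S → Matrix (Fin M × Fin b) ι F
  /-- the reconstruction function, applied to the `S` response vectors -/
  decode : Fin M → (Fin S → ι → F) → Matrix (Fin b) (Fin k) F
  /-- reconstruction uses only the syndromes of the response vectors with respect to the star
  product of `C` and `D`, that is, their classes modulo this code -/
  decode_syndrome : ∀ (d : Fin M) (y y' : Fin S → ι → F),
    (∀ s, y s - y' s ∈ starProduct C D) → decode d y = decode d y'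
  /-- the requested file is always recovered -/
  correct : ∀ (d : Fin M) (X : Fin M → Matrix (Fin b) (Fin k) F)
    (R : Fin S → Fin M × Fin b → D),
    decode d (fun s => response (Matrix.of (fun p i => (R s p : ι → F) i + E d s p i))
      (storedMatrix G X)) = X d

/-- The mutual information `I(U; V)` (in bits) of two finitely valued random variables with joint
law `p`. -/
noncomputable def mutualInfo {α β : Type*} [Fintype α] [Fintype β] (p : PMF (α × β)) : ℝ :=
  ∑ u, ∑ v, (p (u, v)).toReal *
    Real.logb 2 ((p (u, v)).toReal /
      (((p.map Prod.fst) u).toReal * ((p.map Prod.snd) v).toReal))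

namespace StarProductScheme

variable {F ι : Type*} [Field F] {k : ℕ} {C D : Submodule F (ι → F)}
  {G : Matrix (Fin k) ι F} {M : ℕ}

/-- The PIR rate `b k / (S nₛ)`: file size over the number of downloaded symbols. -/
noncomputable def rate [Fintype ι] (P : StarProductScheme C D G M) : ℝ :=
  ((P.b : ℝ) * k) / ((P.S : ℝ) * Fintype.card ι)

/-- The queries received by the servers in `T` over all iterations, when file `d` is requested and
the random parts of the query matrices are `R`. -/
def queries (P : StarProductScheme C D G M) (T : Finset ι) (d : Fin M)
    (R : Fin P.S → Fin M × Fin P.b → D) : T → Fin P.S → Fin M × Fin P.b → F :=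
  fun i s p => (R s p : ι → F) i + P.E d s p i

open Classical in
/-- The joint law of the queries seen by `T` and the demand, when the demand has law `μ` and,
independently of it, all rows of all random parts are independent and uniform on `D`. -/
noncomputable def jointLaw [Fintype F] [Fintype ι] (P : StarProductScheme C D G M) (T : Finset ι)
    (μ : PMF (Fin M)) : PMF ((T → Fin P.S → Fin M × Fin P.b → F) × Fin M) :=
  μ.bind fun d =>
    (PMF.uniformOfFintype (Fin P.S → Fin M × Fin P.b → D)).map fun R => (P.queries T d R, d)

open Classical in
/-- The scheme is a `t`-PIR scheme: for every set `T` of `t` servers and every law of the demand,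
the queries seen by `T` and the demand have mutual information zero. -/
def IsPrivate [Fintype F] [Fintype ι] (P : StarProductScheme C D G M) (t : ℕ) : Prop :=
  ∀ T : Finset ι, T.card = t → ∀ μ : PMF (Fin M), mutualInfo (P.jointLaw T μ) = 0

end StarProductScheme

/-- The code `C` has storage rate `Rst`, and for every number `M` of files and every generator
matrix `G` of `C`, the storage system `Y = X G` has a star product `t`-PIR scheme with retrieval
code `D` and PIR rate `Rpir`. -/
def HasStarProductPIR {F ι : Type*} [Field F] [Fintype F] [Fintype ι]
    (C D : Submodule F (ι → F)) (Rst Rpir : ℝ) (t : ℕ) : Prop :=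
  (Module.finrank F C : ℝ) / Fintype.card ι = Rst ∧
  ∀ (M k : ℕ) (G : Matrix (Fin k) ι F), IsGeneratorMatrix G C →
    ∃ P : StarProductScheme C D G M, P.rate = Rpir ∧ P.IsPrivate t

/-! ### Dual codes and information sets -/

/-! The proof separates a general scheme from the arithmetic of Berman codes. Let `V` be a proper
code containing `C ⋆ D`. The random codewords change a response only by an element of `V`, so what
can be read is the designed part of the response modulo `V`. If `C ≠ 0` and `V` are invariant under
an abelian group acting on the servers by translation, designed queries supported on translates of
the complement of an information set of `V` read every file row on a translate of an information set
of `C`; this gives rate `(N - dim V) / N` (`exists_starProductScheme_of_translation_invariant`).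
Privacy against `t` servers holds once every nonzero word of the dual of `D` has weight above `t`,
since `D` then projects onto any `t` coordinates and masks the queries uniformly.

Dual Berman codes behave like polynomials filtered by degree: `D_r ⋆ D_s ⊆ D_{r+s}`
(`mul_mem_dualBerman`). Since `B_r` is the dual of `D_r` (`mem_berman_iff`), also `D_r ⋆ B_s ⊆
B_{s-r}` for `r ≤ s`. Both families are invariant under the translations of `(ℤ/n)^m`. Hence `V` can
be taken in the same families, and the rates and `t` follow from the dimensions and minimum
distances, all found by induction on the block decomposition. -/

/-- The dual code of `C` with respect to the dot product. -/
def dualCode {F ι : Type*} [Field F] [Fintype ι] (C : Submodule F (ι → F)) :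
    Submodule F (ι → F) :=
  LinearMap.BilinForm.orthogonal (dotProductBilin F F) C

section DualCode

variable {F ι : Type*} [Field F] [Fintype ι]

theorem mem_dualCode {C : Submodule F (ι → F)} {v : ι → F} :
    v ∈ dualCode C ↔ ∀ c ∈ C, c ⬝ᵥ v = 0 := Iff.rfl

theorem dotProductBilin_isRefl :
    LinearMap.BilinForm.IsRefl (dotProductBilin F F : LinearMap.BilinForm F (ι → F)) :=
  fun x y h => (dotProduct_comm y x).trans h

theorem dotProductBilin_nondegenerate :
    LinearMap.BilinForm.Nondegenerate (dotProductBilin F F : LinearMap.BilinForm F (ι → F)) :=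
  ⟨fun v h => dotProduct_eq_zero v h,
    fun v h => dotProduct_eq_zero v fun w => (dotProduct_comm v w).trans (h w)⟩

theorem dualCode_dualCode (C : Submodule F (ι → F)) : dualCode (dualCode C) = C :=
  LinearMap.BilinForm.orthogonal_orthogonal dotProductBilin_nondegenerate
    dotProductBilin_isRefl C

theorem finrank_dualCode (C : Submodule F (ι → F)) :
    Module.finrank F (dualCode C) = Fintype.card ι - Module.finrank F C := by
  have h := LinearMap.BilinForm.finrank_orthogonal
    (dotProductBilin_nondegenerate (F := F) (ι := ι)) C
  rwa [Module.finrank_fintype_fun_eq_card] at h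

/-- Greedy choice: fixing to zero a coordinate that is not identically zero on the remaining subcode
strictly lowers its dimension. -/
theorem exists_finset_card_le_finrank (C : Submodule F (ι → F)) :
    ∃ J : Finset ι, J.card ≤ Module.finrank F C ∧ ∀ x ∈ C, (∀ j ∈ J, x j = 0) → x = 0 := by
  classical
  induction h : Module.finrank F C using Nat.strong_induction_on generalizing C with
  | _ k ih =>
    by_cases hC : ∃ x ∈ C, x ≠ 0
    · obtain ⟨x, hx, hx0⟩ := hC
      obtain ⟨i, hi⟩ := Function.ne_iff.mp hx0
      let C' := C ⊓ LinearMap.ker (LinearMap.proj (R := F) (φ := fun _ : ι => F) i)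
      have hlt : Module.finrank F C' < k := by
        rw [← h]
        refine Submodule.finrank_lt_finrank_of_lt (lt_of_le_of_ne inf_le_left fun he => ?_)
        have : x ∈ C' := he ▸ hx
        exact hi this.2
      obtain ⟨J, hJ, hJ0⟩ := ih _ hlt C' rfl
      refine ⟨insert i J, (Finset.card_insert_le i J).trans (by omega), fun y hy hy0 => ?_⟩
      exact hJ0 y ⟨hy, hy0 i (Finset.mem_insert_self i J)⟩
        fun j hj => hy0 j (Finset.mem_insert_of_mem hj)
    · push Not at hC
      exact ⟨∅, by simp, fun x hx _ => hC x hx⟩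

/-- Every code has an information set. -/
theorem exists_informationSet (C : Submodule F (ι → F)) :
    ∃ J : Finset ι, J.card = Module.finrank F C ∧ ∀ x ∈ C, (∀ j ∈ J, x j = 0) → x = 0 := by
  obtain ⟨J, hJ, hJ0⟩ := exists_finset_card_le_finrank C
  have hle : Module.finrank F C ≤ Fintype.card ι :=
    (Submodule.finrank_le C).trans (Module.finrank_fintype_fun_eq_card F).le
  obtain ⟨J', hJJ', hc⟩ := Finset.exists_superset_card_eq hJ hle
  exact ⟨J', hc, fun x hx h => hJ0 x hx fun j hj => h j (hJJ' hj)⟩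

/-- If every nonzero word of the dual code has weight larger than `#T`, then the code projects
onto the coordinates in `T`. -/
theorem exists_mem_eqOn_of_lt_weight [DecidableEq F] (D : Submodule F (ι → F)) (T : Finset ι)
    (hT : ∀ y ∈ dualCode D, y ≠ 0 → T.card < hammingNorm y) (x : ι → F) :
    ∃ d ∈ D, ∀ i ∈ T, d i = x i := by
  classical
  -- A word orthogonal to all words vanishing on `T` is supported on `T`. The dual of `D ⊔ K` thus
  -- consists of dual words of weight at most `#T`, so it is zero.
  let K : Submodule F (ι → F) :=
    { carrier := {z | ∀ i ∈ T, z i = 0}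
      add_mem' := fun {a b} ha hb i hi => by simp [ha i hi, hb i hi]
      zero_mem' := fun i _ => rfl
      smul_mem' := fun c a ha i hi => by simp [ha i hi] }
  suffices h : D ⊔ K = ⊤ by
    obtain ⟨d, hd, z, hz, hdz⟩ := Submodule.mem_sup.mp (h ▸ Submodule.mem_top : x ∈ D ⊔ K)
    refine ⟨d, hd, fun i hi => ?_⟩
    rw [← hdz, Pi.add_apply, hz i hi, add_zero]
  have hbot : dualCode (D ⊔ K) = ⊥ := by
    refine (Submodule.eq_bot_iff _).mpr fun y hy => ?_
    by_contra hy0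
    refine (hT y (fun c hc => hy c (Submodule.mem_sup_left hc)) hy0).not_ge ?_
    refine Finset.card_le_card fun i hi => ?_
    by_contra hiT
    refine (Finset.mem_filter.mp hi).2 ?_
    have h1 : Pi.single i (1 : F) ∈ K := fun j hj => by
      rw [Pi.single_apply, if_neg]
      rintro rfl
      exact hiT hj
    have h2 := mem_dualCode.mp hy _ (Submodule.mem_sup_right h1)
    rwa [single_one_dotProduct] at h2
  rw [← dualCode_dualCode (D ⊔ K), hbot]
  exact (Submodule.eq_top_iff').mpr fun v c hc => by
    rw [(Submodule.mem_bot F).mp hc]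
    exact zero_dotProduct v

theorem translation_mem_dualCode [AddCommGroup ι] {C : Submodule F (ι → F)}
    (hC : ∀ x ∈ C, ∀ g : ι, (fun i => x (g + i)) ∈ C) :
    ∀ x ∈ dualCode C, ∀ g : ι, (fun i => x (g + i)) ∈ dualCode C := by
  intro x hx g c hc
  rw [← mem_dualCode.mp hx _ (hC c hc (-g))]
  exact Fintype.sum_equiv (Equiv.addLeft g) _ _ fun i => by simp

end DualCode

/-! ### Privacy -/

theorem PMF.map_equiv_uniformOfFintype {α : Type*} [Fintype α] [Nonempty α] (e : α ≃ α) :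
    (PMF.uniformOfFintype α).map e = PMF.uniformOfFintype α := by
  classical
  ext a
  rw [PMF.map_apply, tsum_eq_single (e.symm a)]
  · simp
  · intro b hb
    rw [if_neg]
    rintro rfl
    simp at hb

/-- Independent random variables have mutual information zero. -/
theorem mutualInfo_bind_map_prodMk {α β : Type*} [Fintype α] [Fintype β] (q : PMF α)
    (μ : PMF β) : mutualInfo (μ.bind fun d => q.map fun u => (u, d)) = 0 := by
  classical
  have hfst : (μ.bind fun d => q.map fun u => (u, d)).map Prod.fst = q := by
    rw [PMF.map_bind]
    simp only [PMF.map_comp]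
    exact PMF.bind_const μ (q.map id) |>.trans (PMF.map_id q)
  have hsnd : (μ.bind fun d => q.map fun u => (u, d)).map Prod.snd = μ := by
    rw [PMF.map_bind]
    simp only [PMF.map_comp]
    refine (congrArg μ.bind (funext fun d => ?_)).trans (PMF.bind_pure μ)
    exact PMF.map_const q d
  have happ : ∀ u v, (μ.bind fun d => q.map fun u => (u, d)) (u, v) = q u * μ v := by
    intro u v
    rw [PMF.bind_apply, tsum_eq_single v, PMF.map_apply, tsum_eq_single u]
    · simp [mul_comm]
    · intro u' hu'
      simp [hu'.symm]
    · intro v' hv'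
      rw [PMF.map_apply]
      simp [hv'.symm]
  refine Finset.sum_eq_zero fun u _ => Finset.sum_eq_zero fun v _ => ?_
  rw [hfst, hsnd, happ, ENNReal.toReal_mul]
  rcases eq_or_ne ((q u).toReal * (μ v).toReal) 0 with h | h
  · rw [h, zero_mul]
  · rw [div_self h, Real.logb_one, mul_zero]

namespace StarProductScheme

/-- A star product scheme is a `t`-PIR scheme if its retrieval code projects onto every set of
`t` coordinates. -/
theorem isPrivate_of_forall_exists_eqOn {F ι : Type*} [Field F] [Fintype F] [Fintype ι] {k M : ℕ}
    {C D : Submodule F (ι → F)} {G : Matrix (Fin k) ι F} (P : StarProductScheme C D G M)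
    {t : ℕ} (ht : ∀ T : Finset ι, T.card = t → ∀ x : ι → F, ∃ d ∈ D, ∀ i ∈ T, d i = x i) :
    P.IsPrivate t := by
  intro T hT μ
  classical
  choose f hf hfT using ht T hT
  let ρ : (Fin P.S → Fin M × Fin P.b → D) → T → Fin P.S → Fin M × Fin P.b → F :=
    fun R i s p => (R s p : ι → F) i
  have hq : ∀ d : Fin M, (PMF.uniformOfFintype (Fin P.S → Fin M × Fin P.b → D)).map
      (P.queries T d) = (PMF.uniformOfFintype (Fin P.S → Fin M × Fin P.b → D)).map ρ := by
    intro d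
    -- On `T` the designed part coincides with the codewords `R₀`, so adding it amounts to the shift
    -- `R ↦ R + R₀`, which preserves the uniform law. The law of the queries therefore does not
    -- depend on `d`.
    let R₀ : Fin P.S → Fin M × Fin P.b → D := fun s p => ⟨f (P.E d s p), hf _⟩
    conv_rhs => rw [← PMF.map_equiv_uniformOfFintype (Equiv.addRight R₀)]
    rw [PMF.map_comp]
    congr 1
    funext R i s p
    simp [queries, ρ, R₀, hfT (P.E d s p) i i.2]
  have h : P.jointLaw T μ = μ.bind fun d =>
      ((PMF.uniformOfFintype (Fin P.S → Fin M × Fin P.b → D)).map ρ).map fun u => (u, d) := by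
    unfold jointLaw
    congr 1
    funext d
    rw [← hq d, PMF.map_comp]
    rfl
  rw [h]
  exact mutualInfo_bind_map_prodMk _ μ

end StarProductScheme

/-! ### Star product schemes for translation invariant codes -/

section Scheme

variable {F ι : Type*} [Field F]

theorem mul_mem_starProduct {C D : Submodule F (ι → F)} {c d : ι → F} (hc : c ∈ C)
    (hd : d ∈ D) : c * d ∈ starProduct C D :=
  Submodule.subset_span ⟨c, hc, d, hd, rfl⟩

theorem IsGeneratorMatrix.finrank_eq {k : ℕ} {G : Matrix (Fin k) ι F} {C : Submodule F (ι → F)}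
    (hG : IsGeneratorMatrix G C) : Module.finrank F C = k := by
  rw [← hG.2, finrank_span_eq_card hG.1, Fintype.card_fin]

theorem storedMatrix_apply {k b M : ℕ} (G : Matrix (Fin k) ι F)
    (X : Fin M → Matrix (Fin b) (Fin k) F) (p : Fin M × Fin b) :
    storedMatrix G X p = Matrix.vecMul (X p.1 p.2) G := rfl

theorem IsGeneratorMatrix.vecMul_mem {k : ℕ} {G : Matrix (Fin k) ι F}
    {C : Submodule F (ι → F)} (hG : IsGeneratorMatrix G C) (x : Fin k → F) :
    Matrix.vecMul x G ∈ C := by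
  rw [← hG.2, Matrix.vecMul_eq_sum]
  exact Submodule.sum_mem _ fun j _ => Submodule.smul_mem _ _
    (Submodule.subset_span ⟨j, rfl⟩)

theorem IsGeneratorMatrix.eq_zero_of_vecMul_eq_zero {k : ℕ} {G : Matrix (Fin k) ι F}
    {C : Submodule F (ι → F)} (hG : IsGeneratorMatrix G C) {x : Fin k → F}
    (hx : Matrix.vecMul x G = 0) : x = 0 := by
  rw [Matrix.vecMul_eq_sum] at hx
  exact funext (Fintype.linearIndependent_iff.mp hG.1 x hx)

theorem storedMatrix_sub {k b M : ℕ} (G : Matrix (Fin k) ι F)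
    (X X' : Fin M → Matrix (Fin b) (Fin k) F) :
    storedMatrix G (X - X') = storedMatrix G X - storedMatrix G X' :=
  funext fun p => Matrix.sub_vecMul G (X p.1 p.2) (X' p.1 p.2)

theorem response_sub {b M : ℕ} (Q Y Y' : Matrix (Fin M × Fin b) ι F) :
    response Q (Y - Y') = response Q Y - response Q Y' := by
  funext i
  simp [response, mul_sub]

/-- The random part of the queries does not change the syndrome of the response. -/
theorem response_add_sub_response_mem {k b M : ℕ} {G : Matrix (Fin k) ι F}
    {C D : Submodule F (ι → F)} (hG : IsGeneratorMatrix G C)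
    (X : Fin M → Matrix (Fin b) (Fin k) F) (R : Fin M × Fin b → D)
    (E : Matrix (Fin M × Fin b) ι F) :
    response (Matrix.of fun p i => (R p : ι → F) i + E p i) (storedMatrix G X) -
      response E (storedMatrix G X) ∈ starProduct C D := by
  have h : response (Matrix.of fun p i => (R p : ι → F) i + E p i) (storedMatrix G X) -
      response E (storedMatrix G X) = ∑ p, storedMatrix G X p * (R p : ι → F) := by
    funext i
    simp only [response, Pi.sub_apply, Matrix.of_apply, ← Finset.sum_sub_distrib,
      Finset.sum_apply, Pi.mul_apply]
    refine Finset.sum_congr rfl fun p _ => ?_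
    ring
  rw [h]
  exact Submodule.sum_mem _ fun p _ => mul_mem_starProduct (hG.vecMul_mem _) (R p).2

/-- The scheme that reads off the wanted file from the classes of the response vectors modulo a
code containing the star product. -/
noncomputable def StarProductScheme.ofSeparating {k M : ℕ} {G : Matrix (Fin k) ι F}
    {C D V : Submodule F (ι → F)} (hG : IsGeneratorMatrix G C) (hV : starProduct C D ≤ V)
    (b S : ℕ) (hb : 0 < b) (hS : 0 < S) (E : Fin M → Fin S → Matrix (Fin M × Fin b) ι F)
    (hE : ∀ (d : Fin M) (X : Fin M → Matrix (Fin b) (Fin k) F),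
      (∀ s, response (E d s) (storedMatrix G X) ∈ V) → X d = 0) :
    StarProductScheme C D G M where
  b := b
  S := S
  b_pos := hb
  S_pos := hS
  E := E
  -- Any tuple of files consistent with the observed classes will do: by `hE`, two consistent tuples
  -- have the same file `d`.
  decode d y :=
    Classical.epsilon (fun X : Fin M → Matrix (Fin b) (Fin k) F =>
      ∀ s, y s - response (E d s) (storedMatrix G X) ∈ V) d
  decode_syndrome d y y' h := by
    have : (fun X : Fin M → Matrix (Fin b) (Fin k) F =>
          ∀ s, y s - response (E d s) (storedMatrix G X) ∈ V) =
        fun X => ∀ s, y' s - response (E d s) (storedMatrix G X) ∈ V := by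
      funext X
      refine propext (forall_congr' fun s => ?_)
      rw [← Submodule.add_mem_iff_right V (hV (h s)) (y := y' s - _), sub_add_sub_cancel]
    simp only [this]
  correct d X R := by
    have hX : ∀ s, response (Matrix.of fun p i => (R s p : ι → F) i + E d s p i)
        (storedMatrix G X) - response (E d s) (storedMatrix G X) ∈ V := fun s =>
      hV (response_add_sub_response_mem hG X (R s) (E d s))
    have h := Classical.epsilon_spec (p := fun X' : Fin M → Matrix (Fin b) (Fin k) F =>
        ∀ s, response (Matrix.of fun p i => (R s p : ι → F) i + E d s p i)
          (storedMatrix G X) - response (E d s) (storedMatrix G X') ∈ V) ⟨X, hX⟩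
    refine sub_eq_zero.mp (hE d (Classical.epsilon _ - X) fun s => ?_)
    rw [storedMatrix_sub, response_sub, ← sub_sub_sub_cancel_left]
    exact V.sub_mem (hX s) (h s)

/-- Translation invariant storage codes have a star product scheme of PIR rate `1 - dim V / N`, for
every translation invariant code `V` containing the star product. -/
theorem exists_starProductScheme_of_translation_invariant [Fintype ι] [AddCommGroup ι]
    {C D V : Submodule F (ι → F)} (hCD : starProduct C D ≤ V)
    (hC : ∀ x ∈ C, ∀ g : ι, (fun i => x (g + i)) ∈ C)
    (hV : ∀ x ∈ V, ∀ g : ι, (fun i => x (g + i)) ∈ V)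
    (hC0 : 0 < Module.finrank F C) (hV1 : Module.finrank F V < Fintype.card ι)
    {k : ℕ} {G : Matrix (Fin k) ι F} (hG : IsGeneratorMatrix G C) (M : ℕ) :
    ∃ P : StarProductScheme C D G M, P.rate =
      ((Fintype.card ι - Module.finrank F V : ℕ) : ℝ) / (Fintype.card ι : ℝ) := by
  classical
  obtain ⟨J, hJ, hJ0⟩ := exists_informationSet C
  obtain ⟨I', hI', hI0⟩ := exists_informationSet V
  let I : Finset ι := I'ᶜ
  have hI : I.card = Fintype.card ι - Module.finrank F V := by rw [Finset.card_compl, hI']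
  have hN : 0 < Fintype.card ι := Fintype.card_pos
  -- Iterations are pairs `(g, j)` and file rows are pairs `(h, i)`. With `k = #J` the rate becomes
  -- `N #I k / (N #J N) = #I / N`.
  let eS : Fin (Fintype.card ι * J.card) ≃ ι × J :=
    Fintype.equivOfCardEq (by simp)
  let eb : Fin (Fintype.card ι * I.card) ≃ ι × I :=
    Fintype.equivOfCardEq (by simp)
  -- In iteration `(g, j)` the server `g + i`, for `i ∈ I`, is asked for the row `(h, i)` of file
  -- `d` with `h + j = g + i`; the other servers get zero. The response lives on `g + I`, and row
  -- `(h, i)` is always read on `h + J`.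
  let E : Fin M → Fin (Fintype.card ι * J.card) →
      Matrix (Fin M × Fin (Fintype.card ι * I.card)) ι F := fun d s => Matrix.of fun p x =>
    if p.1 = d ∧ x = (eS s).1 + (eb p.2).2 ∧ x = (eb p.2).1 + (eS s).2 then 1 else 0
  have hresp : ∀ d s (Y : Matrix (Fin M × Fin (Fintype.card ι * I.card)) ι F) (i : I),
      response (E d s) Y ((eS s).1 + i) =
        Y (d, eb.symm ((eS s).1 + i - (eS s).2, i)) ((eS s).1 + i) := by
    intro d s Y i
    rw [response, Finset.sum_eq_single (d, eb.symm ((eS s).1 + i - (eS s).2, i))]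
    · simp [E]
    · rintro ⟨f, a⟩ - hp
      simp only [E, Matrix.of_apply]
      rw [if_neg, zero_mul]
      rintro ⟨hf, h1, h2⟩
      refine hp (Prod.ext hf ?_)
      rw [Equiv.eq_symm_apply]
      have h3 : i = (eb a).2 := Subtype.ext (add_left_cancel h1)
      exact Prod.ext (eq_sub_of_add_eq h2.symm) h3.symm
    · simp
  have hresp0 : ∀ d s (Y : Matrix (Fin M × Fin (Fintype.card ι * I.card)) ι F) (i : ι), i ∉ I →
      response (E d s) Y ((eS s).1 + i) = 0 := by
    intro d s Y i hi
    refine Finset.sum_eq_zero fun p _ => ?_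
    simp only [E, Matrix.of_apply]
    rw [if_neg, zero_mul]
    rintro ⟨-, h1, -⟩
    exact hi (add_left_cancel h1 ▸ (eb p.2).2.2)
  have hE : ∀ (d : Fin M) (X : Fin M → Matrix (Fin (Fintype.card ι * I.card)) (Fin k) F),
      (∀ s, response (E d s) (storedMatrix G X) ∈ V) → X d = 0 := by
    intro d X hX
    -- Translated by `g`, the response is a word of `V` vanishing on the information set `I'`.
    have hz : ∀ s i, response (E d s) (storedMatrix G X) ((eS s).1 + i) = 0 := fun s =>
      congrFun (hI0 _ (hV _ (hX s) (eS s).1) fun j hj =>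
        hresp0 d s _ j fun h => Finset.mem_compl.mp h hj)
    funext a
    refine hG.eq_zero_of_vecMul_eq_zero ?_
    have hrow : (fun i => Matrix.vecMul (X d a) G ((eb a).1 + i)) = 0 := by
      refine hJ0 _ (hC _ (hG.vecMul_mem _) _) fun j hj => ?_
      -- The iteration with `g = h + j - i` is the one that reads row `(h, i)` at server `h + j`.
      have h1 := hz (eS.symm ((eb a).1 + j - (eb a).2, ⟨j, hj⟩)) (eb a).2
      rw [hresp] at h1
      simpa [storedMatrix_apply] using h1
    funext x
    simpa using congrFun hrow (x - (eb a).1)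
  refine ⟨StarProductScheme.ofSeparating hG hCD _ _ (Nat.mul_pos hN (by omega))
    (Nat.mul_pos hN (by omega)) E hE, ?_⟩
  have hk : J.card = k := hJ.trans hG.finrank_eq
  have hk0 : (k : ℝ) ≠ 0 := by
    rw [← hk, hJ]
    exact_mod_cast hC0.ne'
  have hN0 : (Fintype.card ι : ℝ) ≠ 0 := by exact_mod_cast hN.ne'
  simp only [StarProductScheme.rate, StarProductScheme.ofSeparating, ← hI, hk]
  push_cast
  field_simp

/-- Translation invariant storage codes have a star product `t`-PIR scheme of PIR rate
`1 - dim V / N`, for every translation invariant code `V` containing the star product, if the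
minimum distance of the dual of the retrieval code is larger than `t`. -/
theorem hasStarProductPIR_of_translation_invariant [Fintype F] [DecidableEq F] [Fintype ι]
    [AddCommGroup ι] {C D V : Submodule F (ι → F)} {t : ℕ}
    (hCD : ∀ c ∈ C, ∀ d ∈ D, c * d ∈ V)
    (hC : ∀ x ∈ C, ∀ g : ι, (fun i => x (g + i)) ∈ C)
    (hV : ∀ x ∈ V, ∀ g : ι, (fun i => x (g + i)) ∈ V)
    (hC0 : 0 < Module.finrank F C) (hV1 : Module.finrank F V < Fintype.card ι)
    (hD : ∀ y ∈ dualCode D, y ≠ 0 → t < hammingNorm y) :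
    HasStarProductPIR C D ((Module.finrank F C : ℝ) / (Fintype.card ι : ℝ))
      (((Fintype.card ι - Module.finrank F V : ℕ) : ℝ) / (Fintype.card ι : ℝ)) t := by
  have hle : starProduct C D ≤ V := Submodule.span_le.mpr <| by
    rintro _ ⟨c, hc, d, hd, rfl⟩
    exact hCD c hc d hd
  refine ⟨rfl, fun M k G hG => ?_⟩
  obtain ⟨P, hP⟩ :=
    exists_starProductScheme_of_translation_invariant hle hC hV hC0 hV1 hG M
  refine ⟨P, hP, P.isPrivate_of_forall_exists_eqOn fun T hT => ?_⟩
  exact exists_mem_eqOn_of_lt_weight D T (hT ▸ hD)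

end Scheme

/-! ### Structure of the Berman codes and their duals -/

section Berman

variable {n : ℕ}

/-- The vector with prescribed blocks. -/
def ofBlocks {n m : ℕ} (w : Fin n → (Fin m → Fin n) → ZMod 2) :
    (Fin (m + 1) → Fin n) → ZMod 2 :=
  fun i => w (i 0) (Fin.tail i)

@[simp]
theorem block_ofBlocks {n m : ℕ} (w : Fin n → (Fin m → Fin n) → ZMod 2) (l : Fin n) :
    block (ofBlocks w) l = w l := by
  funext i
  simp [block, ofBlocks]

theorem block_ext {n m : ℕ} {v w : (Fin (m + 1) → Fin n) → ZMod 2}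
    (h : ∀ l, block v l = block w l) : v = w := by
  funext i
  have := congrFun (h (i 0)) (Fin.tail i)
  simpa [block] using this

theorem sum_eq_sum_block {n m : ℕ} {M : Type*} [AddCommMonoid M]
    (f : (Fin (m + 1) → Fin n) → M) :
    ∑ i, f i = ∑ l, ∑ j : Fin m → Fin n, f (Fin.cons l j) := by
  rw [← Fintype.sum_prod_type']
  exact (Fintype.sum_equiv (Fin.consEquiv fun _ : Fin (m + 1) => Fin n) _ _ fun _ => rfl).symm

theorem dotProduct_eq_sum_block {n m : ℕ} (v w : (Fin (m + 1) → Fin n) → ZMod 2) :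
    v ⬝ᵥ w = ∑ l, block v l ⬝ᵥ block w l :=
  sum_eq_sum_block _

theorem hammingNorm_eq_sum_block {n m : ℕ} (v : (Fin (m + 1) → Fin n) → ZMod 2) :
    hammingNorm v = ∑ l, hammingNorm (block v l) := by
  simp only [hammingNorm, Finset.card_filter]
  exact sum_eq_sum_block _

theorem dualBerman_of_le : ∀ {m r : ℕ}, m ≤ r → dualBerman n m r = ⊤
  | 0, _, _ => by rw [dualBerman]
  | m + 1, 0, h => by omega
  | m + 1, r + 1, h => by rw [dualBerman, if_pos (by omega)]

theorem berman_of_le : ∀ {m r : ℕ}, m ≤ r → berman n m r = ⊥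
  | 0, _, _ => by rw [berman]
  | m + 1, 0, h => by omega
  | m + 1, r + 1, h => by rw [berman, if_pos (by omega)]

theorem mem_dualBerman_zero {m : ℕ} {v : (Fin (m + 1) → Fin n) → ZMod 2} :
    v ∈ dualBerman n (m + 1) 0 ↔ ∃ c : ZMod 2, v = fun _ => c := by
  rw [dualBerman]
  rfl

theorem mem_berman_zero {m : ℕ} {v : (Fin (m + 1) → Fin n) → ZMod 2} :
    v ∈ berman n (m + 1) 0 ↔ ∑ i, v i = 0 := by
  rw [berman]
  rfl

/-- The vectors `u` and `u_l` are forced, since the last block is `u` itself. For `m ≤ r` every code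
involved is the full space, so the recursion needs no bound on `r` and later inductions have no
boundary case. -/
theorem mem_dualBerman_succ {m r : ℕ} {v : (Fin (m + 1) → Fin (n + 1)) → ZMod 2} :
    v ∈ dualBerman (n + 1) (m + 1) (r + 1) ↔
      block v (Fin.last n) ∈ dualBerman (n + 1) m (r + 1) ∧
        ∀ l, block v l - block v (Fin.last n) ∈ dualBerman (n + 1) m r := by
  by_cases h : m ≤ r
  · rw [dualBerman_of_le (by omega : m + 1 ≤ r + 1), dualBerman_of_le h,
      dualBerman_of_le (by omega : m ≤ r + 1)]
    simp
  rw [dualBerman, if_neg h]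
  constructor
  · rintro ⟨u, hu, w, hw, hw0, hv⟩
    have hl : block v (Fin.last n) = u := by rw [hv, hw0 _ (by simp), add_zero]
    refine ⟨hl ▸ hu, fun l => ?_⟩
    rw [hl, hv l, add_sub_cancel_left]
    exact hw l
  · rintro ⟨hu, hw⟩
    refine ⟨_, hu, fun l => block v l - block v (Fin.last n), hw, fun l hl => ?_,
      fun l => (add_sub_cancel _ _).symm⟩
    have : l = Fin.last n := Fin.ext (by simpa using hl)
    rw [this]
    exact sub_self _

theorem mem_berman_succ {m r : ℕ} {v : (Fin (m + 1) → Fin n) → ZMod 2} :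
    v ∈ berman n (m + 1) (r + 1) ↔
      (∀ l, block v l ∈ berman n m r) ∧ ∑ l, block v l ∈ berman n m (r + 1) := by
  by_cases h : m ≤ r
  · rw [berman_of_le (by omega : m + 1 ≤ r + 1), berman_of_le h,
      berman_of_le (by omega : m ≤ r + 1)]
    simp only [Submodule.mem_bot]
    constructor
    · rintro rfl
      exact ⟨fun l => rfl, Finset.sum_eq_zero fun l _ => rfl⟩
    · exact fun hv => block_ext hv.1
  · rw [berman, if_neg h]
    rfl

theorem const_mem_dualBerman : ∀ (m r : ℕ) (c : ZMod 2),
    (fun _ => c) ∈ dualBerman (n + 1) m r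
  | 0, r, c => by rw [dualBerman]; trivial
  | m + 1, 0, c => mem_dualBerman_zero.mpr ⟨c, rfl⟩
  | m + 1, r + 1, c => mem_dualBerman_succ.mpr
      ⟨const_mem_dualBerman m (r + 1) c, fun l => by
        have h : block (fun _ : Fin (m + 1) → Fin (n + 1) => c) l
            - block (fun _ => c) (Fin.last n) = 0 := sub_self (fun _ : Fin m → Fin (n + 1) => c)
        rw [h]
        exact Submodule.zero_mem _⟩

theorem dualBerman_le_succ : ∀ m r : ℕ, dualBerman (n + 1) m r ≤ dualBerman (n + 1) m (r + 1)
  | 0, r => by simp [dualBerman]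
  | m + 1, 0 => fun v hv => by
      obtain ⟨c, rfl⟩ := mem_dualBerman_zero.mp hv
      exact const_mem_dualBerman _ _ c
  | m + 1, r + 1 => fun v hv => by
      obtain ⟨h1, h2⟩ := mem_dualBerman_succ.mp hv
      exact mem_dualBerman_succ.mpr ⟨dualBerman_le_succ m (r + 1) h1,
        fun l => dualBerman_le_succ m r (h2 l)⟩

theorem block_mem_dualBerman {m r : ℕ} {v : (Fin (m + 1) → Fin (n + 1)) → ZMod 2}
    (hv : v ∈ dualBerman (n + 1) (m + 1) (r + 1)) (l : Fin (n + 1)) :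
    block v l ∈ dualBerman (n + 1) m (r + 1) := by
  obtain ⟨h1, h2⟩ := mem_dualBerman_succ.mp hv
  rw [← sub_add_cancel (block v l) (block v (Fin.last n))]
  exact Submodule.add_mem _ (dualBerman_le_succ m r (h2 l)) h1

theorem block_sub_block_mem_dualBerman {m r : ℕ} {v : (Fin (m + 1) → Fin (n + 1)) → ZMod 2}
    (hv : v ∈ dualBerman (n + 1) (m + 1) (r + 1)) (l l' : Fin (n + 1)) :
    block v l - block v l' ∈ dualBerman (n + 1) m r := by
  obtain ⟨-, h2⟩ := mem_dualBerman_succ.mp hv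
  rw [← sub_sub_sub_cancel_right _ _ (block v (Fin.last n))]
  exact Submodule.sub_mem _ (h2 l) (h2 l')

/-- Leibniz rule for block differences: `v_l w_l - v w = (v_l - v) w_l + v (w_l - w)`, where `v`,
`w` are the last blocks. Each difference lowers the order by one. -/
theorem mul_mem_dualBerman : ∀ {m r s : ℕ} {v w : (Fin m → Fin (n + 1)) → ZMod 2},
    v ∈ dualBerman (n + 1) m r → w ∈ dualBerman (n + 1) m s →
      v * w ∈ dualBerman (n + 1) m (r + s)
  | 0, r, s, v, w, _, _ => by rw [dualBerman]; trivial
  | m + 1, 0, s, v, w, hv, hw => by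
      obtain ⟨c, rfl⟩ := mem_dualBerman_zero.mp hv
      rw [zero_add]
      exact Submodule.smul_mem _ c hw
  | m + 1, r + 1, 0, v, w, hv, hw => by
      obtain ⟨c, rfl⟩ := mem_dualBerman_zero.mp hw
      rw [mul_comm]
      exact Submodule.smul_mem _ c hv
  | m + 1, r + 1, s + 1, v, w, hv, hw => by
      rw [show r + 1 + (s + 1) = r + s + 1 + 1 by omega]
      refine mem_dualBerman_succ.mpr ⟨?_, fun l => ?_⟩
      · have h := mul_mem_dualBerman (block_mem_dualBerman hv (Fin.last n))
          (block_mem_dualBerman hw (Fin.last n))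
        rwa [show r + 1 + (s + 1) = r + s + 1 + 1 by omega] at h
      · have h1 := mul_mem_dualBerman (block_sub_block_mem_dualBerman hv l (Fin.last n))
          (block_mem_dualBerman hw l)
        have h2 := mul_mem_dualBerman (block_mem_dualBerman hv (Fin.last n))
          (block_sub_block_mem_dualBerman hw l (Fin.last n))
        rw [add_right_comm] at h2
        have h := Submodule.add_mem _ h1 h2
        rwa [sub_mul, mul_sub, sub_add_sub_cancel] at h

/-- A translation permutes the blocks cyclically and translates each of them. The last block plays
no special role: all blocks lie in the code of order `r + 1` and all differences of blocks in that
of order `r`. -/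
theorem translation_mem_dualBerman : ∀ {m r : ℕ} {v : (Fin m → Fin (n + 1)) → ZMod 2},
    v ∈ dualBerman (n + 1) m r → ∀ g : Fin m → Fin (n + 1),
      (fun i => v (g + i)) ∈ dualBerman (n + 1) m r
  | 0, r, v, _, g => by rw [dualBerman]; trivial
  | m + 1, 0, v, hv, g => by
      obtain ⟨c, rfl⟩ := mem_dualBerman_zero.mp hv
      exact hv
  | m + 1, r + 1, v, hv, g => by
      have hb : ∀ l, block (fun i => v (g + i)) l =
          fun i => block v (g 0 + l) (Fin.tail g + i) := by
        intro l
        funext i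
        refine congrArg v (funext fun j => ?_)
        refine Fin.cases ?_ (fun j => ?_) j <;> simp [Fin.tail]
      refine mem_dualBerman_succ.mpr ⟨?_, fun l => ?_⟩
      · rw [hb]
        exact translation_mem_dualBerman (block_mem_dualBerman hv _) _
      · rw [hb, hb]
        exact translation_mem_dualBerman (block_sub_block_mem_dualBerman hv _ _) _

theorem mem_berman_iff : ∀ {m r : ℕ} {v : (Fin m → Fin (n + 1)) → ZMod 2},
    v ∈ berman (n + 1) m r ↔ ∀ c ∈ dualBerman (n + 1) m r, c ⬝ᵥ v = 0
  | 0, r, v => by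
      rw [berman, dualBerman, Submodule.mem_bot]
      constructor
      · rintro rfl c -
        exact dotProduct_zero c
      · exact fun h => dotProduct_eq_zero v fun w => (dotProduct_comm v w).trans (h w trivial)
  | m + 1, 0, v => by
      rw [mem_berman_zero]
      constructor
      · rintro h c hc
        obtain ⟨c, rfl⟩ := mem_dualBerman_zero.mp hc
        simp [dotProduct, ← Finset.mul_sum, h]
      · intro h
        have := h _ (const_mem_dualBerman _ _ 1)
        simpa [dotProduct] using this
  | m + 1, r + 1, v => by
      rw [mem_berman_succ]
      constructor
      · rintro ⟨h1, h2⟩ c hc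
        obtain ⟨h3, h4⟩ := mem_dualBerman_succ.mp hc
        have hl : ∀ l, block c l ⬝ᵥ block v l = block c (Fin.last n) ⬝ᵥ block v l := fun l => by
          rw [← sub_eq_zero, ← sub_dotProduct]
          exact mem_berman_iff.mp (h1 l) _ (h4 l)
        rw [dotProduct_eq_sum_block, Finset.sum_congr rfl fun l _ => hl l, ← dotProduct_sum]
        exact mem_berman_iff.mp h2 _ h3
      · intro h
        have hsum : ∑ l, block v l ∈ berman (n + 1) m (r + 1) := by
          refine mem_berman_iff.mpr fun c hc => ?_
          -- Testing against `(c|⋯|c)` isolates the sum of the blocks; below, testing against a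
          -- single nonzero block isolates one block other than the last.
          have := h (ofBlocks fun _ => c) (mem_dualBerman_succ.mpr (by simp [hc]))
          rw [dotProduct_eq_sum_block] at this
          simpa [dotProduct_sum] using this
        have hne : ∀ l, l ≠ Fin.last n → block v l ∈ berman (n + 1) m r := by
          refine fun l hl => mem_berman_iff.mpr fun c hc => ?_
          have hm : ofBlocks (Pi.single l c) ∈ dualBerman (n + 1) (m + 1) (r + 1) := by
            refine mem_dualBerman_succ.mpr ⟨by simp [hl.symm], fun l' => ?_⟩
            simp only [block_ofBlocks, Pi.single_eq_of_ne hl.symm, sub_zero]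
            rcases eq_or_ne l' l with rfl | hl'
            · simpa using hc
            · simp [hl']
          have := h _ hm
          rw [dotProduct_eq_sum_block, Finset.sum_eq_single l] at this
          · simpa using this
          · intro l' _ hl'
            simp [hl']
          · simp
        -- The last block is the total sum minus the other blocks, so this inclusion gives its
        -- membership.
        have hmono : berman (n + 1) m (r + 1) ≤ berman (n + 1) m r := fun x hx =>
          mem_berman_iff.mpr fun c hc => mem_berman_iff.mp hx c (dualBerman_le_succ m r hc)
        refine ⟨fun l => ?_, hsum⟩
        rcases eq_or_ne l (Fin.last n) with rfl | hl
        · rw [Fin.sum_univ_castSucc] at hsum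
          have h2 : ∑ l : Fin n, block v l.castSucc ∈ berman (n + 1) m r :=
            Submodule.sum_mem _ fun l _ => hne _ (Fin.castSucc_lt_last l).ne
          exact (Submodule.add_mem_iff_right _ h2).mp (hmono hsum)
        · exact hne l hl

theorem berman_eq_dualCode (m r : ℕ) :
    berman (n + 1) m r = dualCode (dualBerman (n + 1) m r) :=
  Submodule.ext fun _ => mem_berman_iff

theorem dualBerman_eq_dualCode (m r : ℕ) :
    dualBerman (n + 1) m r = dualCode (berman (n + 1) m r) := by
  rw [berman_eq_dualCode, dualCode_dualCode]

/-- The minimum distance of the Berman code. -/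
theorem two_pow_le_hammingNorm_of_mem_berman :
    ∀ {m r : ℕ} {v : (Fin m → Fin n) → ZMod 2}, v ∈ berman n m r → v ≠ 0 →
      2 ^ (r + 1) ≤ hammingNorm v
  | 0, r, v, hv, h0 => by
      rw [berman] at hv
      exact absurd hv h0
  | m + 1, 0, v, hv, h0 => by
      rw [mem_berman_zero] at hv
      have h1 : 0 < hammingNorm v := hammingNorm_pos_iff.mpr h0
      have h2 : ((hammingNorm v : ℕ) : ZMod 2) = 0 := by
        have h3 : ∀ a : ZMod 2, ((if a ≠ 0 then 1 else 0 : ℕ) : ZMod 2) = a := by decide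
        rw [hammingNorm, Finset.card_filter, Nat.cast_sum]
        exact (Finset.sum_congr rfl fun i _ => h3 (v i)).trans hv
      rw [ZMod.natCast_eq_zero_iff] at h2
      exact Nat.le_of_dvd h1 h2
  | m + 1, r + 1, v, hv, h0 => by
      obtain ⟨h1, h2⟩ := mem_berman_succ.mp hv
      obtain ⟨l, hl⟩ : ∃ l, block v l ≠ 0 := by
        by_contra! h
        exact h0 (block_ext h)
      rw [hammingNorm_eq_sum_block]
      -- Two nonzero blocks contribute `2 ^ (r + 1)` each. A single nonzero block equals the sum of
      -- all blocks, hence lies in the code of order `r + 1`.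
      by_cases h : ∃ l', l' ≠ l ∧ block v l' ≠ 0
      · obtain ⟨l', hl', hl0⟩ := h
        have h3 := two_pow_le_hammingNorm_of_mem_berman (h1 l) hl
        have h4 := two_pow_le_hammingNorm_of_mem_berman (h1 l') hl0
        have h5 := Finset.add_le_sum (s := Finset.univ)
          (f := fun l => hammingNorm (block v l)) (fun _ _ => Nat.zero_le _)
          (Finset.mem_univ l) (Finset.mem_univ l') hl'.symm
        rw [pow_succ]
        exact le_trans (by omega) h5
      · push Not at h
        rw [Finset.sum_eq_single l (fun l' _ hl' => h l' hl') (by simp)] at h2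
        exact (two_pow_le_hammingNorm_of_mem_berman h2 hl).trans
          (Finset.single_le_sum (f := fun l => hammingNorm (block v l))
            (fun _ _ => Nat.zero_le _) (Finset.mem_univ l))

/-- The minimum distance of the dual Berman code. -/
theorem pow_le_hammingNorm_of_mem_dualBerman :
    ∀ {m r : ℕ} {v : (Fin m → Fin (n + 1)) → ZMod 2}, v ∈ dualBerman (n + 1) m r → v ≠ 0 →
      (n + 1) ^ (m - r) ≤ hammingNorm v
  | 0, r, v, hv, h0 => by
      rw [Nat.zero_sub, pow_zero]
      exact hammingNorm_pos_iff.mpr h0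
  | m + 1, 0, v, hv, h0 => by
      obtain ⟨c, rfl⟩ := mem_dualBerman_zero.mp hv
      have hc : c ≠ 0 := fun h => h0 (funext fun _ => h)
      simp [hammingNorm, hc]
  | m + 1, r + 1, v, hv, h0 => by
      rw [hammingNorm_eq_sum_block, Nat.add_sub_add_right]
      -- If no block vanishes, the bound for order `r + 1` is multiplied by the number of blocks. If
      -- some block vanishes, every block is a difference of blocks and has order `r`.
      by_cases h : ∀ l, block v l ≠ 0
      · have h1 := Finset.sum_le_sum fun l (_ : l ∈ Finset.univ) =>
          pow_le_hammingNorm_of_mem_dualBerman (block_mem_dualBerman hv l) (h l)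
        refine le_trans ?_ h1
        rw [Finset.sum_const, Finset.card_univ, Fintype.card_fin, smul_eq_mul, ← pow_succ']
        exact Nat.pow_le_pow_right (by omega) (by omega)
      · push Not at h
        obtain ⟨l₀, hl₀⟩ := h
        obtain ⟨l, hl⟩ : ∃ l, block v l ≠ 0 := by
          by_contra! h
          exact h0 (block_ext h)
        have h1 := block_sub_block_mem_dualBerman hv l l₀
        rw [hl₀, sub_zero] at h1
        exact (pow_le_hammingNorm_of_mem_dualBerman h1 hl).trans
          (Finset.single_le_sum (f := fun l => hammingNorm (block v l))
            (fun _ _ => Nat.zero_le _) (Finset.mem_univ l))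

/-- The Plotkin-type decomposition of the dual Berman code. -/
def dualBermanSuccEquiv (n m r : ℕ) : dualBerman (n + 1) (m + 1) (r + 1) ≃ₗ[ZMod 2]
    dualBerman (n + 1) m (r + 1) × (Fin n → dualBerman (n + 1) m r) where
  toFun v := (⟨block v.1 (Fin.last n), (mem_dualBerman_succ.mp v.2).1⟩,
    fun l => ⟨block v.1 l.castSucc - block v.1 (Fin.last n), (mem_dualBerman_succ.mp v.2).2 _⟩)
  map_add' v w := Prod.ext rfl (funext fun l => Subtype.ext (add_sub_add_comm _ _ _ _))
  map_smul' c v := Prod.ext rfl (funext fun l => Subtype.ext (smul_sub c _ _).symm)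
  invFun p := ⟨ofBlocks (Fin.snoc (fun l => (p.2 l).1 + p.1.1) p.1.1),
    mem_dualBerman_succ.mpr ⟨by simp, fun l => by
      refine Fin.lastCases ?_ (fun l => ?_) l <;> simp⟩⟩
  left_inv v := Subtype.ext (block_ext fun l => by
    refine Fin.lastCases ?_ (fun l => ?_) l <;> simp)
  right_inv p := by
    refine Prod.ext (Subtype.ext ?_) (funext fun l => Subtype.ext ?_) <;> simp

/-- Pascal's rule, in the form of the dimension count given by `dualBermanSuccEquiv`. -/
theorem sum_choose_succ_mul_pow (m r q : ℕ) :
    ∑ i ∈ Finset.range (r + 2), (m + 1).choose i * q ^ i =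
      ∑ i ∈ Finset.range (r + 2), m.choose i * q ^ i +
        q * ∑ i ∈ Finset.range (r + 1), m.choose i * q ^ i := by
  rw [Finset.sum_range_succ' _ (r + 1), Finset.sum_range_succ' (fun i => m.choose i * q ^ i),
    Finset.mul_sum, add_right_comm, ← Finset.sum_add_distrib]
  simp only [Nat.choose_zero_right]
  congr 1
  refine Finset.sum_congr rfl fun i _ => ?_
  rw [Nat.choose_succ_succ, pow_succ]
  ring

theorem finrank_dualBerman : ∀ m r : ℕ, Module.finrank (ZMod 2) (dualBerman (n + 1) m r) =
    ∑ i ∈ Finset.range (r + 1), m.choose i * n ^ i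
  | 0, r => by
      rw [dualBerman, finrank_top, Module.finrank_fintype_fun_eq_card, Finset.sum_range_succ']
      simp
  | m + 1, 0 => by
      have h : dualBerman (n + 1) (m + 1) 0 =
          Submodule.span (ZMod 2) {fun _ : Fin (m + 1) → Fin (n + 1) => (1 : ZMod 2)} := by
        ext v
        rw [mem_dualBerman_zero, Submodule.mem_span_singleton]
        refine exists_congr fun c => ?_
        rw [eq_comm]
        refine iff_of_eq (congrArg (· = v) (funext fun i => ?_))
        simp
      rw [h, finrank_span_singleton fun h => one_ne_zero (congrFun h 0)]
      simp
  | m + 1, r + 1 => by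
      rw [(dualBermanSuccEquiv n m r).finrank_eq, Module.finrank_prod, Module.finrank_pi_fintype,
        sum_choose_succ_mul_pow, finrank_dualBerman m (r + 1)]
      simp [finrank_dualBerman m r]

end Berman

/-! ### Dimensions, products and translation invariance of Berman codes. -/

section Parameters

theorem sum_choose_mul_pow (m n : ℕ) :
    ∑ i ∈ Finset.range (m + 1), m.choose i * n ^ i = (n + 1) ^ m := by
  rw [add_pow]
  refine Finset.sum_congr rfl fun i _ => ?_
  rw [one_pow, mul_one, mul_comm]
  rfl

theorem finrank_berman {n m r : ℕ} (hr : r ≤ m) :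
    Module.finrank (ZMod 2) (berman (n + 1) m r) =
      ∑ i ∈ Finset.Icc (r + 1) m, m.choose i * n ^ i := by
  have h := Finset.sum_range_add_sum_Ico (fun i => m.choose i * n ^ i)
    (Nat.add_le_add_right hr 1)
  rw [sum_choose_mul_pow] at h
  rw [berman_eq_dualCode, finrank_dualCode, finrank_dualBerman, Fintype.card_fun,
    Fintype.card_fin, Fintype.card_fin, ← h, Nat.add_sub_cancel_left]
  rfl

theorem finrank_dualBerman_add_finrank_berman (n m r : ℕ) :
    Module.finrank (ZMod 2) (dualBerman (n + 1) m r) +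
      Module.finrank (ZMod 2) (berman (n + 1) m r) =
        Fintype.card (Fin m → Fin (n + 1)) := by
  rw [berman_eq_dualCode, finrank_dualCode]
  refine Nat.add_sub_cancel' ?_
  exact (Submodule.finrank_le _).trans (Module.finrank_fintype_fun_eq_card _).le

theorem finrank_dualBerman_pos (n m r : ℕ) :
    0 < Module.finrank (ZMod 2) (dualBerman (n + 1) m r) := by
  rw [finrank_dualBerman, Finset.sum_range_succ']
  simp

theorem finrank_berman_pos {n m r : ℕ} (hn : 0 < n) (hr : r < m) :
    0 < Module.finrank (ZMod 2) (berman (n + 1) m r) := by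
  rw [finrank_berman hr.le]
  refine Finset.sum_pos' (fun _ _ => Nat.zero_le _) ⟨m, by simpa using hr, ?_⟩
  simpa using Nat.pow_pos hn

/-- Multiplication by `v` is self-adjoint for the dot product: `c ⬝ᵥ (v * w) = (c * v) ⬝ᵥ w`, and `c
* v` lies in the dual Berman code of order `s`. -/
theorem mul_mem_berman {n m r s : ℕ} (hrs : r ≤ s) {v w : (Fin m → Fin (n + 1)) → ZMod 2}
    (hv : v ∈ dualBerman (n + 1) m r) (hw : w ∈ berman (n + 1) m s) :
    v * w ∈ berman (n + 1) m (s - r) := by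
  refine mem_berman_iff.mpr fun c hc => ?_
  have h := mul_mem_dualBerman hc hv
  rw [Nat.sub_add_cancel hrs] at h
  rw [← mem_berman_iff.mp hw _ h]
  simp only [dotProduct, Pi.mul_apply, mul_assoc]

theorem translation_mem_berman {n m r : ℕ} :
    ∀ v ∈ berman (n + 1) m r, ∀ g : Fin m → Fin (n + 1),
      (fun i => v (g + i)) ∈ berman (n + 1) m r := by
  rw [berman_eq_dualCode]
  exact translation_mem_dualCode fun x hx => translation_mem_dualBerman hx

end Parameters

theorem mainTheorem1 (n m : ℕ) (hn : 2 ≤ n) (hm : 1 ≤ m) :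
    (∀ rC rD : ℕ, rC + rD < m →
      HasStarProductPIR (dualBerman n m rC) (dualBerman n m rD)
        ((∑ i ∈ Finset.Icc 0 rC, (m.choose i : ℝ) * ((n : ℝ) - 1) ^ i) / (n : ℝ) ^ m)
        ((∑ i ∈ Finset.Icc (rC + rD + 1) m, (m.choose i : ℝ) * ((n : ℝ) - 1) ^ i) / (n : ℝ) ^ m)
        (2 ^ (rD + 1) - 1)) ∧
    (∀ rC rD : ℕ, rC ≤ rD → rD ≤ m →
      HasStarProductPIR (dualBerman n m rC) (berman n m rD)
        ((∑ i ∈ Finset.Icc 0 rC, (m.choose i : ℝ) * ((n : ℝ) - 1) ^ i) / (n : ℝ) ^ m)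
        ((∑ i ∈ Finset.Icc 0 (rD - rC), (m.choose i : ℝ) * ((n : ℝ) - 1) ^ i) / (n : ℝ) ^ m)
        (n ^ (m - rD) - 1)) ∧
    (∀ rC rD : ℕ, rD ≤ rC → rC < m →
      HasStarProductPIR (berman n m rC) (dualBerman n m rD)
        ((∑ i ∈ Finset.Icc (rC + 1) m, (m.choose i : ℝ) * ((n : ℝ) - 1) ^ i) / (n : ℝ) ^ m)
        ((∑ i ∈ Finset.Icc 0 (rC - rD), (m.choose i : ℝ) * ((n : ℝ) - 1) ^ i) / (n : ℝ) ^ m)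
        (2 ^ (rD + 1) - 1)) := by
  obtain ⟨n, rfl⟩ : ∃ k, n = k + 1 := ⟨n - 1, by omega⟩
  have hcard : ((Fintype.card (Fin m → Fin (n + 1)) : ℕ) : ℝ) = ((n + 1 : ℕ) : ℝ) ^ m := by simp
  have hD : ∀ r, ∑ i ∈ Finset.Icc 0 r, (m.choose i : ℝ) * (((n + 1 : ℕ) : ℝ) - 1) ^ i =
      (Module.finrank (ZMod 2) (dualBerman (n + 1) m r) : ℝ) := by
    intro r
    rw [finrank_dualBerman, Finset.range_eq_Ico]
    push_cast
    rw [add_sub_cancel_right]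
    rfl
  have hB : ∀ r, r ≤ m → ∑ i ∈ Finset.Icc (r + 1) m,
      (m.choose i : ℝ) * (((n + 1 : ℕ) : ℝ) - 1) ^ i =
        (Module.finrank (ZMod 2) (berman (n + 1) m r) : ℝ) := by
    intro r hr
    rw [finrank_berman hr]
    push_cast
    rw [add_sub_cancel_right]
  have hsum := finrank_dualBerman_add_finrank_berman n m
  have hDpos := finrank_dualBerman_pos n m
  have hBpos : ∀ r, r < m → _ := fun r => finrank_berman_pos (n := n) (m := m) (by omega)
  have hDinv : ∀ r, ∀ v ∈ dualBerman (n + 1) m r, ∀ g : Fin m → Fin (n + 1),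
      (fun i => v (g + i)) ∈ dualBerman (n + 1) m r := fun r _ => translation_mem_dualBerman
  have hDdist : ∀ r, ∀ y ∈ dualCode (dualBerman (n + 1) m r), y ≠ 0 →
      2 ^ (r + 1) - 1 < hammingNorm y := by
    intro r y hy hy0
    rw [← berman_eq_dualCode] at hy
    exact Nat.sub_one_lt_of_le (by positivity) (two_pow_le_hammingNorm_of_mem_berman hy hy0)
  -- The code `V` is `D_{rC+rD}`, `B_{rD-rC}` and `B_{rC-rD}` respectively. The numerator `N - dim
  -- V` is the dimension of the dual of `V`, whose positivity makes `V` proper.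
  refine ⟨fun rC rD h => ?_, fun rC rD h hrD => ?_, fun rC rD h hrC => ?_⟩
  · have hrank := hsum (rC + rD)
    have hpos := hBpos (rC + rD) h
    rw [hD, hB _ h.le, ← hcard, ← Nat.sub_eq_of_eq_add' hrank.symm]
    exact hasStarProductPIR_of_translation_invariant
      (fun c hc d hd => mul_mem_dualBerman hc hd) (hDinv _) (hDinv _) (hDpos _) (by omega)
      (hDdist _)
  · have hrank := hsum (rD - rC)
    have hpos := hDpos (rD - rC)
    rw [hD, hD, ← hcard, ← Nat.sub_eq_of_eq_add hrank.symm]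
    refine hasStarProductPIR_of_translation_invariant
      (fun c hc d hd => mul_mem_berman h hc hd) (hDinv _) translation_mem_berman (hDpos _)
      (by omega) fun y hy hy0 => ?_
    rw [← dualBerman_eq_dualCode] at hy
    exact Nat.sub_one_lt_of_le (by positivity) (pow_le_hammingNorm_of_mem_dualBerman hy hy0)
  · have hrank := hsum (rC - rD)
    have hpos := hDpos (rC - rD)
    rw [hD, hB _ hrC.le, ← hcard, ← Nat.sub_eq_of_eq_add hrank.symm]
    refine hasStarProductPIR_of_translation_invariant
      (fun c hc d hd => ?_) translation_mem_berman translation_mem_berman (hBpos _ hrC)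
      (by omega) (hDdist _)
    rw [mul_comm]
    exact mul_mem_berman h hd hc
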